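/- A subset of $\mathbb{Z}^k$ is called linear if it has the form $a+B^*=\{a+b : b\in B^*\}$ with $a\in\mathbb{Z}^k$ and $B\subset\mathbb{Z}^k$ finite, where $B^*$ denotes the submonoid of $(\mathbb{Z}^k,+)$ generated by $B$; it is called semilinear if it is a finite (possibly empty) union of linear sets. A semilinear expression for a set $X\subseteq\mathbb{Z}^k$ consists of elements $a_1,\ldots,a_d\in\mathbb{Z}^k$ and finite sets $B_1,\ldots,B_d\subset\mathbb{Z}^k$ (each given by a list of its elements) with $X=\bigcup_{i=1}^d(a_i+B_i^*)$. Theorem. Let $X$ and $Y$ be semilinear subsets of $\mathbb{Z}^k$. Then $X\setminus Y$ is semilinear, and it is effectively constructible from $X$ and $Y$: there is an algorithm (a total computable function) which, given $k$ and any semilinear expressions for sets $X,Y\subseteq\mathbb{Z}^k$, outputs a semilinear expression for $X\setminus Y$. -/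

import Mathlib

/-- An expression for a linear subset `a + B^*` of `ℤ^k`: the base point `a`, and the finite set
`B` of periods, given by a list of its elements. -/
abbrev LinearExpr (k : ℕ) : Type := (Fin k → ℤ) × List (Fin k → ℤ)

/-- The linear set `a + B^*`, where `B^*` is the submonoid of `ℤ^k` generated by `B`. -/
def LinearExpr.toSet {k : ℕ} (e : LinearExpr k) : Set (Fin k → ℤ) :=
  {x | ∃ b ∈ AddSubmonoid.closure {p : Fin k → ℤ | p ∈ e.2}, x = e.1 + b}

/-- A semilinear expression over `ℤ^k`: a finite list of expressions for linear sets. -/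
abbrev SemilinearExpr (k : ℕ) : Type := List (LinearExpr k)

/-- The semilinear set described by an expression: the union of the linear sets
`a_i + B_i^*`. -/
def SemilinearExpr.toSet {k : ℕ} (E : SemilinearExpr k) : Set (Fin k → ℤ) :=
  {x | ∃ e ∈ E, x ∈ LinearExpr.toSet e}

/-- Semilinear expressions as data for algorithms, with each vector of `ℤ^k` written as a list of
integers. This type does not depend on `k`, so that one algorithm can treat all dimensions. -/
abbrev SemilinearCode : Type := List (List ℤ × List (List ℤ))

/-- The expression written out as data: every vector is replaced by the list of its `k`
coordinates. -/
def SemilinearExpr.code {k : ℕ} (E : SemilinearExpr k) : SemilinearCode :=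
  E.map fun e => (List.ofFn e.1, e.2.map fun p => List.ofFn p)

/-! Semilinearity of the difference is Mathlib's `IsSemilinearSet.sdiff`; the work lies in the
algorithm, an unbounded search for a certificate. A certificate records splittings of `X` and `Y`
into linear pieces, with data for a primitive recursive test that every piece of `X` either lies in
one of the given linear sets of `Y` or is disjoint from all pieces of `Y`. The pieces passing the
disjointness test then describe `X \ Y` (`VecOps.toSet_diff`).

The search stops because a certificate always exists (`VecOps.exists_diff_eq_some`). A linear set is
a finite union of linear sets with independent periods, so membership in it depends on finitely many
linear inequalities and on residues modulo some `N`. Splitting makes all pieces homogeneous: periods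
are divisible by `N` and never point towards a bounding hyperplane (`Refines.isHomogeneous`). A
homogeneous piece of `X` with base in a linear set `f` of `Y` lies in `f`; by Dickson's lemma,
multiples of its periods are sums of periods of `f`, so after one more splitting a bounded search
confirms the inclusion. If the base is outside `Y`, an inequality or a congruence separates the
piece from each homogeneous piece of `Y` (`VecOps.exists_separates`). -/

namespace Primrec

/-! ### Primitive recursive operations on integers and lists -/

section Int

theorem int_ofNat : Primrec (fun n : ℕ => (n : ℤ)) :=
  encode_iff.1 <| nat_double.of_eq fun _ => rfl

theorem int_negSucc : Primrec Int.negSucc :=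
  encode_iff.1 <| nat_double_succ.of_eq fun _ => rfl

/-- The code of an integer is `2 * n` or `2 * n + 1`: its parity selects the constructor and its
half is the argument. -/
theorem int_casesOn {α σ : Type*} [Primcodable α] [Primcodable σ] {f : α → ℤ} {g h : α → ℕ → σ}
    (hf : Primrec f) (hg : Primrec₂ g) (hh : Primrec₂ h) :
    Primrec fun a => (Int.casesOn (f a) (g a) (h a) : σ) := by
  have e : Primrec fun a => Encodable.encode (f a) := Primrec.encode.comp hf
  refine (Primrec.cond (nat_bodd.comp e) (hh.comp .id (nat_div2.comp e))
    (hg.comp .id (nat_div2.comp e))).of_eq fun a => ?_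
  rcases f a with n | n
  · rw [show Encodable.encode (Int.ofNat n) = 2 * n from rfl]
    simp
  · rw [show Encodable.encode (Int.negSucc n) = 2 * n + 1 from rfl]
    simp

theorem int_neg : Primrec (fun z : ℤ => -z) := by
  refine (int_casesOn (g := fun _ n => Nat.casesOn n 0 Int.negSucc)
    (h := fun _ n => ((n + 1 : ℕ) : ℤ)) .id
    (nat_casesOn .snd (.const 0) (int_negSucc.comp .snd).to₂).to₂
    (int_ofNat.comp (succ.comp .snd)).to₂).of_eq fun z => ?_
  rcases z with (_ | n) | n <;> rfl

theorem int_natSub : Primrec₂ (fun m n : ℕ => (m : ℤ) - n) := by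
  refine (Primrec.ite (c := fun p : ℕ × ℕ => p.2 ≤ p.1) (nat_le.comp .snd .fst)
    (int_ofNat.comp (nat_sub.comp .fst .snd))
    (int_neg.comp (int_ofNat.comp (nat_sub.comp .snd .fst)))).of_eq fun p => ?_
  dsimp only
  split_ifs with h <;> omega

theorem int_toNat : Primrec Int.toNat := by
  refine (int_casesOn (g := fun _ n => n) (h := fun _ _ => 0) .id .right (.const 0)).of_eq
    fun z => ?_
  rcases z with n | n <;> rfl

theorem int_add : Primrec₂ (fun x y : ℤ => x + y) := by
  have p : Primrec fun z : ℤ × ℤ => z.1.toNat + z.2.toNat :=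
    nat_add.comp (int_toNat.comp .fst) (int_toNat.comp .snd)
  have q : Primrec fun z : ℤ × ℤ => (-z.1).toNat + (-z.2).toNat :=
    nat_add.comp (int_toNat.comp (int_neg.comp .fst)) (int_toNat.comp (int_neg.comp .snd))
  refine (int_natSub.comp p q).of_eq fun z => ?_
  push_cast
  omega

theorem int_sub : Primrec₂ (fun x y : ℤ => x - y) :=
  (int_add.comp .fst (int_neg.comp .snd)).of_eq fun z => (sub_eq_add_neg z.1 z.2).symm

theorem int_mul : Primrec₂ (fun x y : ℤ => x * y) := by
  have a : Primrec fun z : ℤ × ℤ => z.1.toNat := int_toNat.comp .fst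
  have b : Primrec fun z : ℤ × ℤ => (-z.1).toNat := int_toNat.comp (int_neg.comp .fst)
  have c : Primrec fun z : ℤ × ℤ => z.2.toNat := int_toNat.comp .snd
  have d : Primrec fun z : ℤ × ℤ => (-z.2).toNat := int_toNat.comp (int_neg.comp .snd)
  refine (int_natSub.comp (nat_add.comp (nat_mul.comp a c) (nat_mul.comp b d))
    (nat_add.comp (nat_mul.comp a d) (nat_mul.comp b c))).of_eq fun z => ?_
  conv_rhs => rw [← Int.toNat_sub_toNat_neg z.1, ← Int.toNat_sub_toNat_neg z.2]
  push_cast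
  ring

theorem int_le : PrimrecRel (fun x y : ℤ => x ≤ y) := by
  refine (Primrec.eq.comp (int_toNat.comp int_sub) (.const 0)).of_eq fun z => ?_
  change (z.1 - z.2).toNat = 0 ↔ z.1 ≤ z.2
  omega

theorem int_natAbs : Primrec Int.natAbs := by
  refine (nat_add.comp int_toNat (int_toNat.comp int_neg)).of_eq fun z => ?_
  omega

theorem int_natCast_dvd : PrimrecRel (fun (n : ℕ) (z : ℤ) => (n : ℤ) ∣ z) := by
  refine (Primrec.eq.comp (nat_mod.comp (int_natAbs.comp .snd) .fst) (.const 0)).of_eq fun z => ?_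
  dsimp only
  rw [← Nat.dvd_iff_mod_eq_zero, Int.natCast_dvd]

end Int

section List

variable {α β γ σ : Type*} [Primcodable α] [Primcodable β] [Primcodable γ] [Primcodable σ]

theorem list_all {f : α → List β} {p : α → β → Bool} (hf : Primrec f) (hp : Primrec₂ p) :
    Primrec fun a => (f a).all (p a) := by
  refine (list_foldr (h := fun a z => p a z.1 && z.2) hf (.const true)
    (Primrec.and.comp (hp.comp .fst (fst.comp .snd)) (snd.comp .snd))).of_eq fun a => ?_
  induction f a <;> simp_all

theorem list_any {f : α → List β} {p : α → β → Bool} (hf : Primrec f) (hp : Primrec₂ p) :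
    Primrec fun a => (f a).any (p a) := by
  refine (list_foldr (h := fun a z => p a z.1 || z.2) hf (.const false)
    (Primrec.or.comp (hp.comp .fst (fst.comp .snd)) (snd.comp .snd))).of_eq fun a => ?_
  induction f a <;> simp_all

theorem list_filter {f : α → List β} {p : α → β → Bool} (hf : Primrec f) (hp : Primrec₂ p) :
    Primrec fun a => (f a).filter (p a) := by
  refine (list_flatMap (g := fun a b => bif p a b then [b] else []) hf
    (Primrec.cond hp (list_cons.comp .snd (.const [])) (.const [])).to₂).of_eq fun a => ?_
  induction f a with
  | nil => rfl
  | cons b l ih => cases h : p a b <;> simp_all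

theorem list_zipWith {f : α → List β} {g : α → List γ} {h : β → γ → σ} [Inhabited β] [Inhabited γ]
    (hf : Primrec f) (hg : Primrec g) (hh : Primrec₂ h) :
    Primrec fun a => List.zipWith h (f a) (g a) := by
  refine (list_map (g := fun a i => h ((f a).getI i) ((g a).getI i))
    (list_range.comp (nat_min.comp (list_length.comp hf) (list_length.comp hg)))
    -- Indices stay below both lengths, so the default values of `getI` never enter.
    (hh.comp (list_getI.comp (hf.comp .fst) .snd) (list_getI.comp (hg.comp .fst) .snd))).of_eq
    fun a => ?_
  refine List.ext_getElem (by simp) fun i h₁ h₂ => ?_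
  simp only [List.length_zipWith, lt_min_iff] at h₂
  simp [List.getI_eq_getElem _ h₂.1, List.getI_eq_getElem _ h₂.2]

theorem list_sum {f : α → List ℤ} (hf : Primrec f) : Primrec fun a => (f a).sum :=
  (list_foldr (h := fun _ z => z.1 + z.2) hf (.const 0)
    (int_add.comp (fst.comp .snd) (snd.comp .snd))).of_eq fun _ => rfl

end List

end Primrec

/-! ### Certificates and their verification -/

/-- The operations on vectors that the algorithm uses: addition, multiplication by a natural
number, and the pairing with a list of integer coefficients. -/
structure VecOps (V : Type*) where
  add : V → V → V
  smul : ℕ → V → V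
  dot : List ℤ → V → ℤ

/-- Vectors written as lists of coordinates. -/
def VecOps.list : VecOps (List ℤ) where
  add := List.zipWith (· + ·)
  smul n := List.map ((n : ℤ) * ·)
  dot h v := (List.zipWith (· * ·) h v).sum

/-- Vectors of `ℤ^k`. -/
def VecOps.pi (k : ℕ) : VecOps (Fin k → ℤ) where
  add := (· + ·)
  smul := (· • ·)
  dot h v := VecOps.list.dot h (List.ofFn v)

/-- Move the entry with index `i` to the front of a list. -/
def List.bring {α : Type*} (i : ℕ) (P : List α) : List α :=
  match P[i]? with
  | none => P
  | some p => p :: (P.take i ++ P.drop (i + 1))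

/-- A certificate for a difference `X \ Y`: the lists of operations to be run on expressions for
`X` and for `Y` (`none` moves the first piece to the end, `some c` splits it), a search depth for
inclusions, and a list of linear functionals and moduli that separate pieces. -/
abbrev DiffCert : Type :=
  (List (Option (ℕ × ℕ)) × List (Option (ℕ × ℕ))) × ℕ × List (List ℤ × ℕ)

namespace VecOps

variable {V W : Type*} (o : VecOps V)

/-- Split `a + (p :: R)^*` into `a + R^*` and `(a + p) + (p :: R)^*`. -/
def splitBase (l : V × List V) : List (V × List V) :=
  match l.2 with
  | [] => [l]
  | p :: R => [(l.1, R), (o.add l.1 p, p :: R)]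

/-- Split `a + (p :: q :: R)^*` along the ray spanned by `p + q`. -/
def splitCone (l : V × List V) : List (V × List V) :=
  match l.2 with
  | [] => [l]
  | p :: Q =>
    match Q with
    | [] => [l]
    | q :: R => [(l.1, o.add p q :: q :: R), (l.1, p :: o.add p q :: R)]

/-- Split `a + (p :: R)^*` into the pieces `(a + r p) + ((m + 1) p :: R)^*` with `r ≤ m`. -/
def splitMul (m : ℕ) (l : V × List V) : List (V × List V) :=
  match l.2 with
  | [] => [l]
  | p :: R => (List.range (m + 1)).map fun r => (o.add l.1 (o.smul r p), o.smul (m + 1) p :: R)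

/-- The splitting operation with a given number. -/
def split (c : ℕ × ℕ) (l : V × List V) : List (V × List V) :=
  if c.1 = 0 then [(l.1, l.2.bring c.2)]
  else if c.1 = 1 then o.splitBase l
  else if c.1 = 2 then o.splitCone l
  else o.splitMul c.2 l

/-- One step on a list of pieces: the first piece is moved to the end or split. -/
def step (S : List (V × List V)) (c : Option (ℕ × ℕ)) : List (V × List V) :=
  match S with
  | [] => []
  | l :: T =>
    match c with
    | none => T ++ [l]
    | some c => o.split c l ++ T

/-- Run a list of operations on a list of pieces. -/
def run (cs : List (Option (ℕ × ℕ))) (S : List (V × List V)) : List (V × List V) :=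
  cs.foldl o.step S

/-- The vectors obtained from `a` by adding at most `n` elements of `Q`. -/
def reach (Q : List V) (n : ℕ) (a : V) : List V :=
  (fun S => S ++ S.flatMap fun x => Q.map (o.add x))^[n] [a]

/-- A sufficient test for `l ⊆ f`. -/
def inside [DecidableEq V] (n : ℕ) (l f : V × List V) : Bool :=
  (o.reach f.2 n f.1).any (fun y => decide (y = l.1)) &&
    l.2.all fun p => (o.reach f.2 n (o.smul 0 f.1)).any fun y => decide (y = p)

/-- A sufficient test for the disjointness of `l` and `f`. -/
def separates (s : List ℤ × ℕ) (l f : V × List V) : Bool :=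
  (!decide (o.dot s.1 l.1 ≤ o.dot s.1 f.1) &&
    (l.2.all (fun p => decide (0 ≤ o.dot s.1 p)) && f.2.all (fun p => decide (o.dot s.1 p ≤ 0)))) ||
  (!decide ((s.2 : ℤ) ∣ o.dot s.1 l.1 - o.dot s.1 f.1) &&
    (l.2.all (fun p => decide ((s.2 : ℤ) ∣ o.dot s.1 p)) &&
      f.2.all (fun p => decide ((s.2 : ℤ) ∣ o.dot s.1 p))))

/-- The test that one of the functionals separates `l` from every element of `F`. -/
def separated (H : List (List ℤ × ℕ)) (F : List (V × List V)) (l : V × List V) : Bool :=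
  F.all fun f => H.any fun s => o.separates s l f

/-- The expression for the difference of `E` and `F` that a certificate provides, if it is valid. -/
def diff [DecidableEq V] (E F : List (V × List V)) (c : DiffCert) : Option (List (V × List V)) :=
  if ((o.run c.1.1 E).all fun l =>
      o.separated c.2.2 (o.run c.1.2 F) l || F.any fun f => o.inside c.2.1 l f) then
    some ((o.run c.1.1 E).filter (o.separated c.2.2 (o.run c.1.2 F)))
  else none

end VecOps

/-! ### Verification is primitive recursive -/

namespace VecOps

open Primrec

theorem primrec_list_add : Primrec₂ VecOps.list.add :=
  list_zipWith .fst .snd int_add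

theorem primrec_list_smul : Primrec₂ VecOps.list.smul :=
  list_map .snd (int_mul.comp (int_ofNat.comp (fst.comp .fst)) .snd).to₂

theorem primrec_list_dot : Primrec₂ VecOps.list.dot :=
  list_sum (list_zipWith .fst .snd int_mul)

theorem primrec_bring {α : Type*} [Primcodable α] :
    Primrec₂ (List.bring : ℕ → List α → List α) := by
  refine (option_casesOn (o := fun z : ℕ × List α => z.2[z.1]?) (f := fun z => z.2)
    (g := fun z p => p :: (z.2.take z.1 ++ z.2.drop (z.1 + 1))) (list_getElem?.comp .snd .fst) .snd
    (list_cons.comp .snd (list_append.comp (list_take.comp (fst.comp .fst) (snd.comp .fst))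
      (list_drop.comp (succ.comp (fst.comp .fst)) (snd.comp .fst)))).to₂).of_eq fun z => ?_
  unfold List.bring
  cases z.2[z.1]? <;> rfl

theorem primrec_splitBase : Primrec VecOps.list.splitBase := by
  refine (list_casesOn (f := fun l : List ℤ × List (List ℤ) => l.2) (g := fun l => [l])
    (h := fun l z => [(l.1, z.2), (VecOps.list.add l.1 z.1, z.1 :: z.2)]) .snd
    (list_cons.comp .id (.const []))
    (list_cons.comp (.pair (fst.comp .fst) (snd.comp .snd))
      (list_cons.comp (.pair (primrec_list_add.comp (fst.comp .fst) (fst.comp .snd))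
        (list_cons.comp (fst.comp .snd) (snd.comp .snd)))
        (.const []))).to₂).of_eq fun l => ?_
  unfold splitBase
  cases l.2 <;> rfl

theorem primrec_splitCone : Primrec VecOps.list.splitCone := by
  have h : Primrec fun z : (List ℤ × List (List ℤ)) × List ℤ × List (List ℤ) =>
      (match z.2.2 with
        | [] => [z.1]
        | q :: R => [(z.1.1, VecOps.list.add z.2.1 q :: q :: R),
            (z.1.1, z.2.1 :: VecOps.list.add z.2.1 q :: R)] :
          List (List ℤ × List (List ℤ))) := by
    have a : Primrec fun z : ((List ℤ × List (List ℤ)) × List ℤ × List (List ℤ)) ×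
        List ℤ × List (List ℤ) => VecOps.list.add z.1.2.1 z.2.1 :=
      primrec_list_add.comp (fst.comp (snd.comp .fst)) (fst.comp .snd)
    refine (list_casesOn (f := fun z : (List ℤ × List (List ℤ)) × List ℤ × List (List ℤ) => z.2.2)
      (g := fun z => [z.1])
      (h := fun z y => [(z.1.1, VecOps.list.add z.2.1 y.1 :: y.1 :: y.2),
            (z.1.1, z.2.1 :: VecOps.list.add z.2.1 y.1 :: y.2)]) (snd.comp .snd)
      (list_cons.comp .fst (.const []))
      (list_cons.comp (.pair (fst.comp (fst.comp .fst)) (list_cons.comp a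
        (list_cons.comp (fst.comp .snd) (snd.comp .snd))))
        (list_cons.comp (.pair (fst.comp (fst.comp .fst))
          (list_cons.comp (fst.comp (snd.comp .fst)) (list_cons.comp a (snd.comp .snd))))
          (.const []))).to₂).of_eq fun z => ?_
    rcases z with ⟨z, p, _ | ⟨q, R⟩⟩ <;> rfl
  refine (list_casesOn (f := fun l : List ℤ × List (List ℤ) => l.2) (g := fun l => [l])
    .snd (list_cons.comp .id (.const [])) h.to₂).of_eq fun l => ?_
  unfold splitCone
  rcases l.2 with _ | ⟨p, _ | ⟨q, R⟩⟩ <;> rfl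

theorem primrec_splitMul : Primrec₂ VecOps.list.splitMul := by
  have h : Primrec₂ fun (z : (ℕ × List ℤ × List (List ℤ)) × List ℤ × List (List ℤ)) (r : ℕ) =>
      (VecOps.list.add z.1.2.1 (VecOps.list.smul r z.2.1),
        VecOps.list.smul (z.1.1 + 1) z.2.1 :: z.2.2) :=
    Primrec.pair
      (primrec_list_add.comp (fst.comp (snd.comp (fst.comp .fst)))
        (primrec_list_smul.comp .snd (fst.comp (snd.comp .fst))))
      (list_cons.comp (primrec_list_smul.comp (succ.comp (fst.comp (fst.comp .fst)))
        (fst.comp (snd.comp .fst))) (snd.comp (snd.comp .fst)))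
  refine (list_casesOn (f := fun z : ℕ × List ℤ × List (List ℤ) => z.2.2) (g := fun z => [z.2])
    (snd.comp .snd) (list_cons.comp .snd (.const []))
    (list_map (list_range.comp (succ.comp (fst.comp .fst))) h).to₂).of_eq fun z => ?_
  unfold splitMul
  cases z.2.2 <;> rfl

theorem primrec_split : Primrec₂ VecOps.list.split :=
  Primrec.ite (Primrec.eq.comp (fst.comp .fst) (.const 0))
    (list_cons.comp (.pair (fst.comp .snd)
      (primrec_bring.comp (snd.comp .fst) (snd.comp .snd))) (.const []))
    (Primrec.ite (Primrec.eq.comp (fst.comp .fst) (.const 1)) (primrec_splitBase.comp .snd)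
      (Primrec.ite (Primrec.eq.comp (fst.comp .fst) (.const 2)) (primrec_splitCone.comp .snd)
        (primrec_splitMul.comp (snd.comp .fst) .snd)))

theorem primrec_step : Primrec₂ VecOps.list.step := by
  have h : Primrec fun z : (List (List ℤ × List (List ℤ)) × Option (ℕ × ℕ)) ×
      (List ℤ × List (List ℤ)) × List (List ℤ × List (List ℤ)) =>
      (Option.casesOn z.1.2 (z.2.2 ++ [z.2.1]) fun c => VecOps.list.split c z.2.1 ++ z.2.2 :
        List (List ℤ × List (List ℤ))) :=
    option_casesOn (snd.comp .fst)
      (list_append.comp (snd.comp .snd) (list_cons.comp (fst.comp .snd) (.const [])))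
      (list_append.comp (primrec_split.comp .snd (fst.comp (snd.comp .fst)))
        (snd.comp (snd.comp .fst))).to₂
  refine (list_casesOn (f := fun z : List (List ℤ × List (List ℤ)) × Option (ℕ × ℕ) => z.1)
    (g := fun _ => []) .fst (.const []) h.to₂).of_eq fun z => ?_
  rcases z with ⟨_ | ⟨l, S⟩, _ | c⟩ <;> rfl

theorem primrec_run : Primrec₂ VecOps.list.run :=
  list_foldl (h := fun _ z => VecOps.list.step z.1 z.2) .fst .snd
    (primrec_step.comp (fst.comp .snd) (snd.comp .snd)).to₂

theorem primrec_reach : Primrec fun z : List (List ℤ) × ℕ × List ℤ =>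
    VecOps.list.reach z.1 z.2.1 z.2.2 := by
  have h : Primrec₂ fun (z : List (List ℤ) × ℕ × List ℤ) (S : List (List ℤ)) =>
      S ++ S.flatMap fun x => z.1.map (VecOps.list.add x) :=
    list_append.comp .snd (list_flatMap .snd
      (list_map (fst.comp (fst.comp .fst)) (primrec_list_add.comp (snd.comp .fst) .snd).to₂).to₂)
  exact nat_iterate (fst.comp .snd) (list_cons.comp (snd.comp .snd) (.const [])) h

theorem primrec_inside : Primrec fun z : ℕ × (List ℤ × List (List ℤ)) × List ℤ × List (List ℤ) =>
    VecOps.list.inside z.1 z.2.1 z.2.2 :=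
  Primrec.and.comp
    (list_any (primrec_reach.comp (.pair (snd.comp (snd.comp .snd))
        (.pair .fst (fst.comp (snd.comp .snd)))))
      (Primrec.eq.comp .snd (fst.comp (fst.comp (snd.comp .fst)))).decide.to₂)
    (list_all (snd.comp (fst.comp .snd))
      (list_any (primrec_reach.comp (.pair (snd.comp (snd.comp (snd.comp .fst)))
        (.pair (fst.comp .fst)
          (primrec_list_smul.comp (.const 0) (fst.comp (snd.comp (snd.comp .fst)))))))
        (Primrec.eq.comp .snd (snd.comp .fst)).decide.to₂).to₂)

theorem primrec_separates :
    Primrec fun z : (List ℤ × ℕ) × (List ℤ × List (List ℤ)) × List ℤ × List (List ℤ) =>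
      VecOps.list.separates z.1 z.2.1 z.2.2 := by
  have a : Primrec fun z : (List ℤ × ℕ) × (List ℤ × List (List ℤ)) × List ℤ × List (List ℤ) =>
      VecOps.list.dot z.1.1 z.2.1.1 :=
    primrec_list_dot.comp (fst.comp .fst) (fst.comp (fst.comp .snd))
  have b : Primrec fun z : (List ℤ × ℕ) × (List ℤ × List (List ℤ)) × List ℤ × List (List ℤ) =>
      VecOps.list.dot z.1.1 z.2.2.1 :=
    primrec_list_dot.comp (fst.comp .fst) (fst.comp (snd.comp .snd))
  have p : Primrec fun z : ((List ℤ × ℕ) × (List ℤ × List (List ℤ)) × List ℤ × List (List ℤ)) ×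
      List ℤ => VecOps.list.dot z.1.1.1 z.2 :=
    primrec_list_dot.comp (fst.comp (fst.comp .fst)) .snd
  have N : Primrec fun z : ((List ℤ × ℕ) × (List ℤ × List (List ℤ)) × List ℤ × List (List ℤ)) ×
      List ℤ => z.1.1.2 := snd.comp (fst.comp .fst)
  have l : Primrec fun z : (List ℤ × ℕ) × (List ℤ × List (List ℤ)) × List ℤ × List (List ℤ) =>
      z.2.1.2 := snd.comp (fst.comp .snd)
  have f : Primrec fun z : (List ℤ × ℕ) × (List ℤ × List (List ℤ)) × List ℤ × List (List ℤ) =>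
      z.2.2.2 := snd.comp (snd.comp .snd)
  exact Primrec.or.comp
    (Primrec.and.comp (Primrec.not.comp (int_le.comp a b).decide)
      (Primrec.and.comp (list_all l (int_le.comp (.const 0) p).decide.to₂)
        (list_all f (int_le.comp p (.const 0)).decide.to₂)))
    (Primrec.and.comp
      (Primrec.not.comp (int_natCast_dvd.comp (snd.comp .fst) (int_sub.comp a b)).decide)
      (Primrec.and.comp (list_all l (int_natCast_dvd.comp N p).decide.to₂)
        (list_all f (int_natCast_dvd.comp N p).decide.to₂)))

theorem primrec_separated :
    Primrec fun z : List (List ℤ × ℕ) × List (List ℤ × List (List ℤ)) × List ℤ × List (List ℤ) =>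
      VecOps.list.separated z.1 z.2.1 z.2.2 :=
  list_all (fst.comp .snd) (list_any (fst.comp .fst)
    (primrec_separates.comp (.pair .snd
      (.pair (snd.comp (snd.comp (fst.comp .fst))) (snd.comp .fst)))).to₂).to₂

theorem primrec_diff :
    Primrec fun z : (SemilinearCode × SemilinearCode) × DiffCert =>
      VecOps.list.diff z.1.1 z.1.2 z.2 := by
  have E : Primrec fun z : (SemilinearCode × SemilinearCode) × DiffCert =>
      VecOps.list.run z.2.1.1 z.1.1 :=
    primrec_run.comp (fst.comp (fst.comp .snd)) (fst.comp .fst)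
  have F : Primrec fun z : (SemilinearCode × SemilinearCode) × DiffCert =>
      VecOps.list.run z.2.1.2 z.1.2 :=
    primrec_run.comp (snd.comp (fst.comp .snd)) (snd.comp .fst)
  have S : Primrec₂ fun (z : (SemilinearCode × SemilinearCode) × DiffCert)
      (l : List ℤ × List (List ℤ)) =>
      VecOps.list.separated z.2.2.2 (VecOps.list.run z.2.1.2 z.1.2) l :=
    primrec_separated.comp (.pair (snd.comp (snd.comp (snd.comp .fst)))
      (.pair (F.comp .fst) .snd))
  refine (Primrec.cond (list_all E (Primrec.or.comp S (list_any (snd.comp (fst.comp .fst))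
    (primrec_inside.comp (.pair (fst.comp (snd.comp (snd.comp (fst.comp .fst))))
      (.pair (snd.comp .fst) .snd))).to₂)).to₂)
    (option_some.comp (list_filter E S)) (.const none)).of_eq fun z => ?_
  rw [diff, cond_eq_ite]

end VecOps

/-! ### Transfer between vectors and coordinate lists -/

theorem List.bring_perm {α : Type*} (i : ℕ) (P : List α) : (P.bring i).Perm P := by
  unfold List.bring
  cases h : P[i]? with
  | none => exact .refl _
  | some p =>
    obtain ⟨hi, rfl⟩ := List.getElem?_eq_some_iff.1 h
    rw [← List.eraseIdx_eq_take_drop_succ]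
    exact List.getElem_cons_eraseIdx_perm hi

theorem List.bring_map {α β : Type*} (φ : α → β) (i : ℕ) (P : List α) :
    (P.map φ).bring i = (P.bring i).map φ := by
  unfold List.bring
  cases h : P[i]? <;> simp [h]

theorem List.exists_bring_eq {α : Type*} {P : List α} {p : α} (hp : p ∈ P) :
    ∃ i R, P.bring i = p :: R := by
  obtain ⟨i, hi, rfl⟩ := List.getElem_of_mem hp
  exact ⟨i, P.take i ++ P.drop (i + 1), by simp [List.bring, hi]⟩

namespace VecOps

section Hom

variable {V W : Type*}

/-- Injective maps that respect the vector operations. -/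
structure IsHom (o : VecOps V) (o' : VecOps W) (φ : V → W) : Prop where
  injective : Function.Injective φ
  map_add : ∀ x y, φ (o.add x y) = o'.add (φ x) (φ y)
  map_smul : ∀ n x, φ (o.smul n x) = o'.smul n (φ x)
  dot_map : ∀ h x, o'.dot h (φ x) = o.dot h x

namespace IsHom

variable {o : VecOps V} {o' : VecOps W} {φ : V → W} (hφ : o.IsHom o' φ)

include hφ

theorem split_map (c : ℕ × ℕ) (l : V × List V) :
    o'.split c (l.map φ (List.map φ)) = (o.split c l).map (Prod.map φ (List.map φ)) := by
  unfold split
  split_ifs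
  · simp [List.bring_map]
  · rcases l with ⟨a, _ | ⟨p, R⟩⟩ <;> simp [splitBase, hφ.map_add]
  · rcases l with ⟨a, _ | ⟨p, _ | ⟨q, R⟩⟩⟩ <;> simp [splitCone, hφ.map_add]
  · rcases l with ⟨a, _ | ⟨p, R⟩⟩ <;> simp [splitMul, hφ.map_add, hφ.map_smul]

theorem run_map (cs : List (Option (ℕ × ℕ))) (S : List (V × List V)) :
    o'.run cs (S.map (Prod.map φ (List.map φ))) = (o.run cs S).map (Prod.map φ (List.map φ)) := by
  induction cs generalizing S with
  | nil => rfl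
  | cons c cs ih =>
    simp only [run, List.foldl_cons] at ih ⊢
    rw [← ih]
    congr 1
    rcases S with _ | ⟨l, S⟩ <;> rcases c with _ | c <;> simp [step, hφ.split_map]

theorem reach_map (Q : List V) (n : ℕ) (a : V) :
    o'.reach (Q.map φ) n (φ a) = (o.reach Q n a).map φ := by
  induction n with
  | zero => rfl
  | succ n ih =>
    simp only [reach, Function.iterate_succ_apply'] at ih ⊢
    rw [ih]
    simp [List.flatMap_map, List.map_flatMap, Function.comp_def, hφ.map_add]

theorem inside_map [DecidableEq V] [DecidableEq W] (n : ℕ) (l f : V × List V) :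
    o'.inside n (l.map φ (List.map φ)) (f.map φ (List.map φ)) = o.inside n l f := by
  simp [inside, Prod.map, hφ.reach_map, ← hφ.map_smul, List.any_map, List.all_map,
    Function.comp_def, hφ.injective.eq_iff]

theorem separates_map (s : List ℤ × ℕ) (l f : V × List V) :
    o'.separates s (l.map φ (List.map φ)) (f.map φ (List.map φ)) = o.separates s l f := by
  simp [separates, Prod.map, hφ.dot_map, List.all_map, Function.comp_def]

/-- Computability concerns coordinate lists, correctness concerns `ℤ^k`. Operations commute with `φ`
and tests keep their Boolean values, equality tests by injectivity. -/
theorem diff_map [DecidableEq V] [DecidableEq W] (E F : List (V × List V)) (c : DiffCert) :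
    o'.diff (E.map (Prod.map φ (List.map φ))) (F.map (Prod.map φ (List.map φ))) c =
      (o.diff E F c).map (List.map (Prod.map φ (List.map φ))) := by
  have h (G : List (V × List V)) (l : V × List V) :
      o'.separated c.2.2 (G.map (Prod.map φ (List.map φ))) (l.map φ (List.map φ)) =
        o.separated c.2.2 G l := by
    simp [separated, List.all_map, Function.comp_def, hφ.separates_map]
  unfold diff
  simp only [hφ.run_map, List.all_map, List.any_map, Function.comp_def, h, hφ.inside_map,
    List.filter_map]
  split_ifs <;> rfl

end IsHom

theorem isHom_ofFn (k : ℕ) : (VecOps.pi k).IsHom VecOps.list List.ofFn where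
  injective := List.ofFn_injective
  map_add x y := by
    refine List.ext_getElem (by simp [VecOps.list]) fun i _ _ => ?_
    simp [VecOps.list, VecOps.pi]
  map_smul n x := by
    refine List.ext_getElem (by simp [VecOps.list]) fun i _ _ => ?_
    simp [VecOps.list, VecOps.pi]
  dot_map _ _ := rfl

end Hom

theorem list_dot_ofFn {k : ℕ} (h x : Fin k → ℤ) :
    VecOps.list.dot (List.ofFn h) (List.ofFn x) = h ⬝ᵥ x := by
  have : List.zipWith (· * ·) (List.ofFn h) (List.ofFn x) = List.ofFn fun i => h i * x i :=
    List.ext_getElem (by simp) fun i _ _ => by simp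
  simp only [VecOps.list, this, List.sum_ofFn, dotProduct]

end VecOps

/-! ### Soundness: a valid certificate yields the difference -/

section Sets

variable {k : ℕ}

theorem LinearExpr.mem_toSet {e : LinearExpr k} {x : Fin k → ℤ} :
    x ∈ e.toSet ↔ ∃ b ∈ AddSubmonoid.closure {p : Fin k → ℤ | p ∈ e.2}, x = e.1 + b := Iff.rfl

theorem SemilinearExpr.mem_toSet {E : SemilinearExpr k} {x : Fin k → ℤ} :
    x ∈ E.toSet ↔ ∃ e ∈ E, x ∈ LinearExpr.toSet e := Iff.rfl

theorem LinearExpr.base_mem (e : LinearExpr k) : e.1 ∈ e.toSet :=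
  ⟨0, zero_mem _, (add_zero _).symm⟩

theorem LinearExpr.add_mem {e : LinearExpr k} {x b : Fin k → ℤ} (hx : x ∈ e.toSet)
    (hb : b ∈ AddSubmonoid.closure {p : Fin k → ℤ | p ∈ e.2}) : x + b ∈ e.toSet := by
  obtain ⟨c, hc, rfl⟩ := hx
  exact ⟨c + b, AddSubmonoid.add_mem _ hc hb, add_assoc _ _ _⟩

theorem LinearExpr.toSet_perm {a : Fin k → ℤ} {P Q : List (Fin k → ℤ)} (h : P.Perm Q) :
    LinearExpr.toSet (a, P) = LinearExpr.toSet (a, Q) := by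
  simp only [LinearExpr.toSet, h.mem_iff]

theorem LinearExpr.mem_toSet_cons {a p x : Fin k → ℤ} {R : List (Fin k → ℤ)} :
    x ∈ LinearExpr.toSet (a, p :: R) ↔ ∃ n : ℕ, x ∈ LinearExpr.toSet (a + n • p, R) := by
  have : {q : Fin k → ℤ | q ∈ p :: R} = {p} ∪ {q | q ∈ R} := by ext; simp
  simp only [LinearExpr.mem_toSet, this, AddSubmonoid.closure_union, AddSubmonoid.mem_sup,
    AddSubmonoid.mem_closure_singleton]
  constructor
  · rintro ⟨_, ⟨_, ⟨n, rfl⟩, b, hb, rfl⟩, rfl⟩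
    exact ⟨n, b, hb, by abel⟩
  · rintro ⟨n, b, hb, rfl⟩
    exact ⟨_, ⟨_, ⟨n, rfl⟩, b, hb, rfl⟩, by abel⟩

theorem SemilinearExpr.toSet_append (S T : SemilinearExpr k) :
    SemilinearExpr.toSet (S ++ T) = S.toSet ∪ T.toSet := by
  ext x
  simp [SemilinearExpr.mem_toSet, or_and_right, exists_or]

theorem SemilinearExpr.toSet_singleton (l : LinearExpr k) :
    SemilinearExpr.toSet [l] = l.toSet := by
  ext x
  simp [SemilinearExpr.mem_toSet]

theorem VecOps.toSet_splitBase (l : LinearExpr k) :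
    SemilinearExpr.toSet ((VecOps.pi k).splitBase l) = l.toSet := by
  rcases l with ⟨a, _ | ⟨p, R⟩⟩
  · exact SemilinearExpr.toSet_singleton _
  ext x
  simp only [splitBase, SemilinearExpr.mem_toSet, List.mem_cons, List.not_mem_nil, or_false,
    exists_eq_or_imp, exists_eq_left, LinearExpr.mem_toSet_cons, VecOps.pi]
  constructor
  · rintro (h | ⟨n, h⟩)
    · exact ⟨0, by simpa using h⟩
    · exact ⟨n + 1, by simpa [add_smul, add_assoc, add_comm p] using h⟩
  · rintro ⟨_ | n, h⟩
    · exact Or.inl (by simpa using h)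
    · exact Or.inr ⟨n, by simpa [add_smul, add_assoc, add_comm p] using h⟩

/-- For `n ≤ m`, `n p + m q = n (p + q) + (m - n) q`, and symmetrically for `m ≤ n`. -/
theorem VecOps.toSet_splitCone (l : LinearExpr k) :
    SemilinearExpr.toSet ((VecOps.pi k).splitCone l) = l.toSet := by
  rcases l with ⟨a, _ | ⟨p, _ | ⟨q, R⟩⟩⟩
  · exact SemilinearExpr.toSet_singleton _
  · exact SemilinearExpr.toSet_singleton _
  ext x
  simp only [splitCone, SemilinearExpr.mem_toSet, List.mem_cons, List.not_mem_nil, or_false,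
    exists_eq_or_imp, exists_eq_left, LinearExpr.mem_toSet_cons, VecOps.pi]
  constructor
  · rintro (⟨n, m, h⟩ | ⟨n, m, h⟩)
    · refine ⟨n, n + m, ?_⟩
      convert h using 2
      rw [add_smul, smul_add]
      abel_nf
    · refine ⟨n + m, m, ?_⟩
      convert h using 2
      rw [add_smul, smul_add]
      abel_nf
  · rintro ⟨n, m, h⟩
    rcases le_total n m with hnm | hnm
    · obtain ⟨r, rfl⟩ := Nat.exists_eq_add_of_le hnm
      refine Or.inl ⟨n, r, ?_⟩
      convert h using 2
      rw [add_smul, smul_add]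
      abel_nf
    · obtain ⟨r, rfl⟩ := Nat.exists_eq_add_of_le' hnm
      refine Or.inr ⟨r, m, ?_⟩
      convert h using 2
      rw [add_smul, smul_add]
      abel_nf

/-- Division with remainder of the coefficient of the first period by `m + 1`. -/
theorem VecOps.toSet_splitMul (m : ℕ) (l : LinearExpr k) :
    SemilinearExpr.toSet ((VecOps.pi k).splitMul m l) = l.toSet := by
  rcases l with ⟨a, _ | ⟨p, R⟩⟩
  · exact SemilinearExpr.toSet_singleton _
  ext x
  simp only [splitMul, SemilinearExpr.mem_toSet, List.mem_map, exists_exists_and_eq_and, List.mem_range,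
    LinearExpr.mem_toSet_cons, VecOps.pi]
  constructor
  · rintro ⟨r, -, n, h⟩
    refine ⟨r + n * (m + 1), ?_⟩
    rwa [add_smul, mul_smul, ← add_assoc]
  · rintro ⟨n, h⟩
    refine ⟨n % (m + 1), Nat.mod_lt _ m.succ_pos, n / (m + 1), ?_⟩
    rwa [add_assoc, ← mul_smul, ← add_smul, Nat.mod_add_div']

theorem VecOps.toSet_split (c : ℕ × ℕ) (l : LinearExpr k) :
    SemilinearExpr.toSet ((VecOps.pi k).split c l) = l.toSet := by
  unfold VecOps.split
  split_ifs
  · exact (SemilinearExpr.toSet_singleton _).trans (LinearExpr.toSet_perm (List.bring_perm _ _))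
  · exact toSet_splitBase l
  · exact toSet_splitCone l
  · exact toSet_splitMul _ l

theorem VecOps.toSet_run (cs : List (Option (ℕ × ℕ))) (S : SemilinearExpr k) :
    SemilinearExpr.toSet ((VecOps.pi k).run cs S) = S.toSet := by
  induction cs generalizing S with
  | nil => rfl
  | cons c cs ih =>
    refine (ih _).trans ?_
    rcases S with _ | ⟨l, S⟩
    · rfl
    · change _ = SemilinearExpr.toSet ([l] ++ S)
      rcases c with _ | c <;>
        simp only [step, SemilinearExpr.toSet_append, SemilinearExpr.toSet_singleton, toSet_split,
          Set.union_comm]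

theorem VecOps.mem_reach {Q : List (Fin k → ℤ)} {n : ℕ} {a x : Fin k → ℤ}
    (hx : x ∈ (VecOps.pi k).reach Q n a) : x ∈ LinearExpr.toSet (a, Q) := by
  induction n generalizing x with
  | zero =>
    rw [List.mem_singleton.1 hx]
    exact LinearExpr.base_mem _
  | succ n ih =>
    rw [reach, Function.iterate_succ_apply', List.mem_append, List.mem_flatMap] at hx
    rcases hx with hx | ⟨y, hy, hx⟩
    · exact ih hx
    · obtain ⟨q, hq, rfl⟩ := List.mem_map.1 hx
      exact LinearExpr.add_mem (ih hy) (AddSubmonoid.subset_closure hq)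

theorem VecOps.toSet_subset_of_inside {n : ℕ} {l f : LinearExpr k}
    (h : (VecOps.pi k).inside n l f = true) : l.toSet ⊆ f.toSet := by
  simp only [inside, Bool.and_eq_true, List.any_eq_true, decide_eq_true_eq, List.all_eq_true,
    exists_eq_right] at h
  obtain ⟨h₁, h₂⟩ := h
  rintro _ ⟨b, hb, rfl⟩
  refine LinearExpr.add_mem (mem_reach h₁) ((AddSubmonoid.closure_le.2 fun p hp => ?_) hb)
  -- `smul 0 f.1` plays the role of the zero vector, so what is reached from it is a sum of periods
  -- of `f`.
  obtain ⟨c, hc, rfl⟩ := mem_reach (h₂ p hp)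
  simpa [VecOps.pi] using hc

/-- Certificates are arbitrary data, so `h` may have any length; truncation by `zipWith` keeps the
pairing additive. -/
theorem VecOps.pi_dot_add (h : List ℤ) (x y : Fin k → ℤ) :
    (VecOps.pi k).dot h (x + y) = (VecOps.pi k).dot h x + (VecOps.pi k).dot h y := by
  simp only [VecOps.pi, VecOps.list]
  induction k generalizing h with
  | zero => simp
  | succ k ih =>
    rcases h with _ | ⟨z, h⟩
    · simp
    · have := ih h (fun i => x i.succ) (fun i => y i.succ)
      change (List.zipWith _ h (List.ofFn fun i => x i.succ + y i.succ)).sum = _ at this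
      simp only [List.ofFn_succ, List.zipWith_cons_cons, List.sum_cons, Pi.add_apply]
      rw [this]
      ring

/-- The linear functional of a list of coefficients. -/
def VecOps.dotHom (k : ℕ) (h : List ℤ) : (Fin k → ℤ) →+ ℤ :=
  AddMonoidHom.mk' ((VecOps.pi k).dot h) (pi_dot_add h)

/-- A common point `l.1 + b = f.1 + c` would contradict the values of the functional, either by size
or modulo `s.2`. -/
theorem VecOps.disjoint_of_separates {s : List ℤ × ℕ} {l f : LinearExpr k}
    (h : (VecOps.pi k).separates s l f = true) : Disjoint l.toSet f.toSet := by
  simp only [separates, Bool.or_eq_true, Bool.and_eq_true, Bool.not_eq_true', decide_eq_false_iff_not,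
    List.all_eq_true, decide_eq_true_eq] at h
  change (¬ dotHom k s.1 l.1 ≤ dotHom k s.1 f.1 ∧ (∀ p ∈ l.2, 0 ≤ dotHom k s.1 p) ∧
    ∀ p ∈ f.2, dotHom k s.1 p ≤ 0) ∨ (¬ (s.2 : ℤ) ∣ dotHom k s.1 l.1 - dotHom k s.1 f.1 ∧
    (∀ p ∈ l.2, (s.2 : ℤ) ∣ dotHom k s.1 p) ∧ ∀ p ∈ f.2, (s.2 : ℤ) ∣ dotHom k s.1 p) at h
  rw [Set.disjoint_left]
  rintro _ ⟨b, hb, rfl⟩ ⟨c, hc, hbc⟩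
  replace hbc := congrArg (dotHom k s.1) hbc
  rw [map_add, map_add] at hbc
  rcases h with ⟨h, hl, hf⟩ | ⟨h, hl, hf⟩
  · have h₁ : 0 ≤ dotHom k s.1 b :=
      (AddSubmonoid.closure_le (S := (AddSubmonoid.nonneg ℤ).comap (dotHom k s.1))).2 hl hb
    have h₂ : 0 ≤ -dotHom k s.1 c :=
      (AddSubmonoid.closure_le (S := (AddSubmonoid.nonneg ℤ).comap (-dotHom k s.1))).2
        (fun p hp => neg_nonneg.2 (hf p hp)) hc
    omega
  · have key (P : List (Fin k → ℤ)) (hP : ∀ p ∈ P, (s.2 : ℤ) ∣ dotHom k s.1 p) :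
        AddSubmonoid.closure {p | p ∈ P} ≤
          ((Ideal.span {(s.2 : ℤ)}).toAddSubmonoid).comap (dotHom k s.1) :=
      AddSubmonoid.closure_le.2 fun p hp => Ideal.mem_span_singleton.2 (hP p hp)
    have h₁ := Ideal.mem_span_singleton.1 (key _ hl hb)
    have h₂ := Ideal.mem_span_singleton.1 (key _ hf hc)
    refine h ?_
    rw [show dotHom k s.1 l.1 - dotHom k s.1 f.1 = dotHom k s.1 c - dotHom k s.1 b by linarith]
    exact dvd_sub h₂ h₁

/-- Separation is tested against the split form of `F`, which describes the same set; inclusion is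
tested against `F` itself. Discarded pieces lie inside `F`, kept ones avoid it. -/
theorem VecOps.toSet_diff {E F D : SemilinearExpr k} {c : DiffCert}
    (h : (VecOps.pi k).diff E F c = some D) : D.toSet = E.toSet \ F.toSet := by
  unfold diff at h
  split_ifs at h with hc
  cases h
  have sep {l : LinearExpr k} (hl : (VecOps.pi k).separated c.2.2 ((VecOps.pi k).run c.1.2 F) l = true) :
      Disjoint l.toSet F.toSet := by
    simp only [separated, List.all_eq_true, List.any_eq_true] at hl
    rw [← toSet_run c.1.2 F, Set.disjoint_left]
    rintro x hx ⟨f, hf, hxf⟩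
    obtain ⟨s, -, hs⟩ := hl f hf
    exact Set.disjoint_left.1 (disjoint_of_separates hs) hx hxf
  rw [← toSet_run c.1.1 E]
  ext x
  constructor
  · rintro ⟨l, hl, hx⟩
    rw [List.mem_filter] at hl
    exact ⟨⟨l, hl.1, hx⟩, Set.disjoint_left.1 (sep hl.2) hx⟩
  · rintro ⟨⟨l, hl, hx⟩, hxF⟩
    refine ⟨l, List.mem_filter.2 ⟨hl, ?_⟩, hx⟩
    have := List.all_eq_true.1 hc l hl
    rw [Bool.or_eq_true, List.any_eq_true] at this
    rcases this with h | ⟨f, hf, hi⟩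
    · exact h
    · exact absurd ⟨f, hf, toSet_subset_of_inside hi hx⟩ hxF

end Sets

/-! ### Splitting into homogeneous pieces -/

section Refinement

variable {k : ℕ} {Q K : LinearExpr k → Prop}

/-- `Refines Q l` means that some sequence of splittings turns `l` into pieces with property `Q`. -/
inductive Refines (Q : LinearExpr k → Prop) : LinearExpr k → Prop
  | leaf (l : LinearExpr k) : Q l → Refines Q l
  | split (c : ℕ × ℕ) (l : LinearExpr k) :
      (∀ l' ∈ (VecOps.pi k).split c l, Refines Q l') → Refines Q l

/-- The base of `l'` lies in `l`, and its periods are sums of periods of `l`. -/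
def LinearExpr.IsPart (l' l : LinearExpr k) : Prop :=
  l'.1 ∈ l.toSet ∧ ∀ p ∈ l'.2, p ∈ AddSubmonoid.closure {p : Fin k → ℤ | p ∈ l.2}

theorem LinearExpr.IsPart.refl (l : LinearExpr k) : l.IsPart l :=
  ⟨l.base_mem, fun _ hp => AddSubmonoid.subset_closure hp⟩

theorem LinearExpr.IsPart.trans {l₁ l₂ l₃ : LinearExpr k} (h : l₁.IsPart l₂) (h' : l₂.IsPart l₃) :
    l₁.IsPart l₃ := by
  have hle := AddSubmonoid.closure_le.2 h'.2
  refine ⟨?_, fun p hp => hle (h.2 p hp)⟩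
  obtain ⟨b, hb, e⟩ := h.1
  rw [e]
  exact LinearExpr.add_mem h'.1 (hle hb)

theorem LinearExpr.isPart_of_mem_split {c : ℕ × ℕ} {l l' : LinearExpr k}
    (h : l' ∈ (VecOps.pi k).split c l) : l'.IsPart l := by
  refine ⟨?_, ?_⟩
  · rw [← VecOps.toSet_split c l]
    exact ⟨l', h, l'.base_mem⟩
  · have mem {p : Fin k → ℤ} (hp : p ∈ l.2) : p ∈ AddSubmonoid.closure {p | p ∈ l.2} :=
      AddSubmonoid.subset_closure hp
    unfold VecOps.split at h
    split_ifs at h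
    · rw [List.mem_singleton.1 h]
      exact fun p hp => mem ((List.bring_perm _ _).mem_iff.1 hp)
    · rcases l with ⟨a, _ | ⟨p, R⟩⟩ <;>
        simp only [VecOps.splitBase, List.mem_cons, List.not_mem_nil, or_false] at h
      · rw [h]
        simp
      · rcases h with rfl | rfl
        · exact fun q hq => mem (List.mem_cons_of_mem _ hq)
        · exact fun q hq => mem hq
    · rcases l with ⟨a, _ | ⟨p, _ | ⟨q, R⟩⟩⟩ <;>
        simp only [VecOps.splitCone, List.mem_cons, List.not_mem_nil, or_false] at h
      · rw [h]
        simp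
      · rw [h]
        exact fun q hq => mem hq
      · have hpq : p + q ∈ AddSubmonoid.closure {x | x ∈ p :: q :: R} :=
          AddSubmonoid.add_mem _ (mem (p := p) (by simp)) (mem (p := q) (by simp))
        rcases h with rfl | rfl <;> intro x hx <;>
          simp only [List.mem_cons, VecOps.pi] at hx <;> rcases hx with rfl | rfl | hx
        exacts [hpq, mem (by simp), mem (by simp [hx]), mem (by simp), hpq, mem (by simp [hx])]
    · rcases l with ⟨a, _ | ⟨p, R⟩⟩
      · rw [List.mem_singleton.1 h]
        simp
      · obtain ⟨r, -, rfl⟩ := List.mem_map.1 h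
        intro x hx
        rcases List.mem_cons.1 hx with rfl | hx
        · exact nsmul_mem (mem (by simp)) _
        · exact mem (by simp [hx])

namespace Refines

theorem bind {l : LinearExpr k} (h : Refines Q l) (hQ : ∀ l, Q l → Refines K l) : Refines K l := by
  induction h with
  | leaf l h => exact hQ l h
  | split c l _ ih => exact .split c l ih

/-- Allows conditions to be imposed one after another: those stable under adding periods persist in
parts. -/
theorem isPart {l : LinearExpr k} (h : Refines Q l) :
    Refines (fun l' => Q l' ∧ l'.IsPart l) l := by
  induction h with
  | leaf l h => exact .leaf _ ⟨h, .refl l⟩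
  | split c l _ ih =>
    exact .split c l fun l' hl' => (ih l' hl').bind fun m hm =>
      .leaf _ ⟨hm.1, hm.2.trans (LinearExpr.isPart_of_mem_split hl')⟩

/-- The list of pieces acts as a queue: finished pieces go to the end and the waiting tail `T` is
untouched, so runs for single pieces can be concatenated. -/
theorem exists_run_of_mem {S : SemilinearExpr k}
    (h : ∀ l ∈ S, ∃ cs L, (∀ l' ∈ L, Q l') ∧ ∀ T, (VecOps.pi k).run cs (l :: T) = T ++ L) :
    ∃ cs L, (∀ l' ∈ L, Q l') ∧ ∀ T, (VecOps.pi k).run cs (S ++ T) = T ++ L := by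
  induction S with
  | nil => exact ⟨[], [], by simp, fun T => by simp [VecOps.run]⟩
  | cons l S ih =>
    obtain ⟨cs, L, hL, hcs⟩ := h l (by simp)
    obtain ⟨cs', L', hL', hcs'⟩ := ih fun l' hl' => h l' (by simp [hl'])
    refine ⟨cs ++ cs', L ++ L', fun l' hl' => (List.mem_append.1 hl').elim (hL l') (hL' l'),
      fun T => ?_⟩
    simp only [VecOps.run] at hcs hcs' ⊢
    rw [List.foldl_append, List.cons_append, hcs, List.append_assoc, hcs', List.append_assoc]

theorem exists_run {S : SemilinearExpr k} (h : ∀ l ∈ S, Refines Q l) :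
    ∃ cs, ∀ l ∈ (VecOps.pi k).run cs S, Q l := by
  have key (l : LinearExpr k) (h : Refines Q l) : ∃ cs L, (∀ l' ∈ L, Q l') ∧
      ∀ T, (VecOps.pi k).run cs (l :: T) = T ++ L := by
    induction h with
    | leaf l h => exact ⟨[none], [l], by simpa using h, fun T => rfl⟩
    | split c l _ ih =>
      obtain ⟨cs, L, hL, hcs⟩ := exists_run_of_mem (S := (VecOps.pi k).split c l) (Q := Q)
        fun l' hl' => ih l' hl'
      exact ⟨some c :: cs, L, hL, hcs⟩
  obtain ⟨cs, L, hL, hcs⟩ := exists_run_of_mem fun l hl => key l (h l hl)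
  refine ⟨cs, ?_⟩
  have := hcs []
  rw [List.append_nil, List.nil_append] at this
  rwa [this]

variable {a p q : Fin k → ℤ} {P R : List (Fin k → ℤ)}

theorem of_bring (hp : p ∈ P) :
    ∃ R, P.Perm (p :: R) ∧ ∀ Q a, Refines Q (a, p :: R) → Refines Q (a, P) := by
  obtain ⟨i, R, h⟩ := List.exists_bring_eq hp
  refine ⟨R, h ▸ (List.bring_perm i P).symm, fun Q a hR => .split (0, i) _ fun l hl => ?_⟩
  rw [List.mem_singleton.1 hl]
  rwa [← h] at hR

theorem of_bring₂ (hp : p ∈ P) (hq : q ∈ P) (hpq : p ≠ q) :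
    ∃ R, P.Perm (p :: q :: R) ∧ ∀ Q a, Refines Q (a, p :: q :: R) → Refines Q (a, P) := by
  obtain ⟨R, hR, hQ⟩ := of_bring hq
  have hpR : p ∈ R := (List.mem_cons.1 (hR.mem_iff.1 hp)).resolve_left hpq
  obtain ⟨i, hi, rfl⟩ := List.getElem_of_mem hpR
  have e : (q :: R).bring (i + 1) = R[i] :: q :: (R.take i ++ R.drop (i + 1)) := by
    simp [List.bring, hi]
  refine ⟨_, hR.trans (e ▸ (List.bring_perm (i + 1) (q :: R)).symm), fun Q a h =>
    hQ _ _ (.split (0, i + 1) _ fun l hl => ?_)⟩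
  rw [List.mem_singleton.1 hl]
  rwa [← e] at h

theorem of_swap (h : Refines Q (a, q :: p :: R)) : Refines Q (a, p :: q :: R) :=
  .split (0, 1) _ fun l hl => by
    rw [List.mem_singleton.1 hl]
    exact h

theorem of_base (h₁ : Refines Q (a, R)) (h₂ : Refines Q (a + p, p :: R)) :
    Refines Q (a, p :: R) := by
  refine .split (1, 0) _ fun l hl => ?_
  rcases List.mem_cons.1 hl with rfl | hl
  · exact h₁
  · rw [List.mem_singleton.1 hl]
    exact h₂

theorem of_cone (h₁ : Refines Q (a, (p + q) :: q :: R)) (h₂ : Refines Q (a, p :: (p + q) :: R)) :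
    Refines Q (a, p :: q :: R) := by
  refine .split (2, 0) _ fun l hl => ?_
  rcases List.mem_cons.1 hl with rfl | hl
  · exact h₁
  · rw [List.mem_singleton.1 hl]
    exact h₂

theorem of_mul {m : ℕ} (hm : 0 < m) (h : ∀ b, Refines Q (b, m • p :: R)) :
    Refines Q (a, p :: R) := by
  -- The code of `splitMul` stores the multiplier minus one.
  obtain ⟨m, rfl⟩ := Nat.exists_eq_add_of_lt hm
  refine .split (3, m) _ fun l hl => ?_
  obtain ⟨r, -, rfl⟩ := List.mem_map.1 hl
  simpa [VecOps.pi] using h (a + r • p)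

open Classical in
/-- Periods may be replaced by multiples. -/
theorem forall_period {G : (Fin k → ℤ) → Prop} (l : LinearExpr k)
    (h : ∀ p ∈ l.2, ∃ m : ℕ, 0 < m ∧ G (m • p)) : Refines (fun l' => ∀ p ∈ l'.2, G p) l := by
  rcases l with ⟨a, P⟩
  induction hn : P.countP (fun p => ¬ G p) using Nat.strong_induction_on generalizing a P with
  | _ n ih
  subst hn
  by_cases hP : ∀ p ∈ P, G p
  · exact .leaf _ hP
  push Not at hP
  obtain ⟨p, hp, hGp⟩ := hP
  obtain ⟨m, hm, hGm⟩ := h p hp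
  obtain ⟨R, hR, hQ⟩ := of_bring hp
  refine hQ _ _ (of_mul hm fun b => ih _ ?_ b _ ?_ rfl)
  · rw [hR.countP_eq]
    simp only [List.countP_cons, hGm, hGp, not_true_eq_false, not_false_eq_true, decide_true,
      decide_false, Bool.false_eq_true, if_false, if_true]
    omega
  · intro q hq
    rcases List.mem_cons.1 hq with rfl | hq
    · exact ⟨1, one_pos, by rwa [one_smul]⟩
    · exact h q (hR.mem_iff.2 (List.mem_cons_of_mem _ hq))

/-- All periods can be brought to the same side of a hyperplane. -/
theorem sign (h : (Fin k → ℤ) →+ ℤ) (l : LinearExpr k) :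
    Refines (fun l' => (∀ p ∈ l'.2, 0 ≤ h p) ∨ ∀ p ∈ l'.2, h p ≤ 0) l := by
  rcases l with ⟨a, P⟩
  induction hn : P.countP (fun p => h p ≠ 0) using Nat.strong_induction_on generalizing a P with
  | _ n ih
  subst hn
  by_cases hP : (∀ p ∈ P, 0 ≤ h p) ∨ ∀ p ∈ P, h p ≤ 0
  · exact .leaf _ hP
  push Not at hP
  obtain ⟨⟨p, hp, hp0⟩, q, hq, hq0⟩ := hP
  obtain ⟨R, hR, hQ⟩ := of_bring₂ hp hq fun e => by subst e; omega
  -- With these multiples, the sum of the two new periods lies on the hyperplane. Each half of the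
  -- cone splitting replaces one of them by that sum, so fewer periods lie off the hyperplane.
  have e : h ((-h p).toNat • q) = -h ((h q).toNat • p) := by
    rw [map_nsmul, map_nsmul, nsmul_eq_mul, nsmul_eq_mul, Int.toNat_of_nonneg hq0.le,
      Int.toNat_of_nonneg (neg_nonneg.2 hp0.le)]
    ring
  refine hQ _ _ (of_mul (m := (h q).toNat) (by omega) fun b => of_swap
    (of_mul (m := (-h p).toNat) (by omega) fun c => of_cone (ih _ ?_ _ _ rfl) (ih _ ?_ _ _ rfl))) <;>
  · rw [hR.countP_eq]
    simp only [List.countP_cons, map_add, e, neg_add_cancel, ne_eq, not_true_eq_false, decide_false,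
      Bool.false_eq_true, if_false, decide_eq_true_eq, hp0.ne, hq0.ne', not_false_eq_true, if_true]
    split_ifs <;> omega

/-- The pieces on one side of a hyperplane can be chosen on one side of a parallel hyperplane. -/
theorem halfspace_of_nonneg (h : (Fin k → ℤ) →+ ℤ) (c : ℤ) (l : LinearExpr k)
    (hl : ∀ p ∈ l.2, 0 ≤ h p) :
    Refines (fun l' => (h l'.1 ≤ c ∧ ∀ p ∈ l'.2, h p ≤ 0) ∨ (c < h l'.1 ∧ ∀ p ∈ l'.2, 0 ≤ h p)) l := by
  rcases l with ⟨a, P⟩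
  -- Splitting off the base either drops the period `p` or raises `h a` by `h p > 0`; both lower
  -- this measure.
  induction hn : P.length + (c + 1 - h a).toNat using Nat.strong_induction_on generalizing a P with
  | _ n ih
  subst hn
  by_cases ha : c < h a
  · exact .leaf _ (.inr ⟨ha, hl⟩)
  by_cases hP : ∀ p ∈ P, h p ≤ 0
  · exact .leaf _ (.inl ⟨not_lt.1 ha, hP⟩)
  push Not at hP
  obtain ⟨p, hp, hp0⟩ := hP
  obtain ⟨R, hR, hQ⟩ := of_bring hp
  refine hQ _ _ (of_base (ih _ ?_ _ _ (fun q hq => hl q ?_) rfl)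
    (ih _ ?_ _ _ (fun q hq => hl q ?_) rfl))
  · rw [hR.length_eq, List.length_cons]
    omega
  · exact hR.mem_iff.2 (List.mem_cons_of_mem _ hq)
  · rw [hR.length_eq, map_add]
    omega
  · exact hR.mem_iff.2 hq

/-- Every piece can be split into pieces on one side of a hyperplane, where moreover the periods
point away from it. -/
theorem halfspace (h : (Fin k → ℤ) →+ ℤ) (c : ℤ) (l : LinearExpr k) :
    Refines (fun l' => (h l'.1 ≤ c ∧ ∀ p ∈ l'.2, h p ≤ 0) ∨ (c < h l'.1 ∧ ∀ p ∈ l'.2, 0 ≤ h p)) l := by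
  refine (sign h l).bind fun l hl => ?_
  rcases hl with hl | hl
  · exact halfspace_of_nonneg h c l hl
  -- Over the integers, `c < h x` means `-h x ≤ -c - 1`.
  · refine (halfspace_of_nonneg (-h) (-c - 1) l fun p hp => ?_).bind fun l' hl' => .leaf _ ?_
    · simpa using hl p hp
    · simp only [AddMonoidHom.neg_apply, neg_nonpos, neg_nonneg] at hl'
      refine hl'.symm.imp (fun h => ⟨?_, h.2⟩) fun h => ⟨?_, h.2⟩ <;> omega

/-- Later splittings preserve earlier conditions: bases move only by sums of periods, which lead no
closer to the hyperplane. -/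
theorem forall_halfspace (H : List (((Fin k → ℤ) →+ ℤ) × ℤ)) (l : LinearExpr k) :
    Refines (fun l' => ∀ s ∈ H, (s.1 l'.1 ≤ s.2 ∧ ∀ p ∈ l'.2, s.1 p ≤ 0) ∨
      (s.2 < s.1 l'.1 ∧ ∀ p ∈ l'.2, 0 ≤ s.1 p)) l := by
  induction H with
  | nil => exact .leaf _ (by simp)
  | cons s H ih =>
    refine ih.bind fun l hl => (halfspace s.1 s.2 l).isPart.bind fun l' hl' => .leaf _ fun t ht => ?_
    rcases List.mem_cons.1 ht with rfl | ht
    · exact hl'.1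
    · have key (f : (Fin k → ℤ) →+ ℤ) (hf : ∀ p ∈ l.2, 0 ≤ f p) :
          f l.1 ≤ f l'.1 ∧ ∀ p ∈ l'.2, 0 ≤ f p := by
        have hle := AddSubmonoid.closure_le (S := (AddSubmonoid.nonneg ℤ).comap f).2 hf
        obtain ⟨b, hb, e⟩ := hl'.2.1
        have : 0 ≤ f b := hle hb
        refine ⟨?_, fun p hp => hle (hl'.2.2 p hp)⟩
        rw [e, map_add]
        omega
      rcases hl t ht with ⟨h₁, h₂⟩ | ⟨h₁, h₂⟩
      · have := key (-t.1) fun p hp => by simpa using h₂ p hp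
        simp only [AddMonoidHom.neg_apply, neg_le_neg_iff, neg_nonneg] at this
        exact .inl ⟨this.1.trans h₁, this.2⟩
      · have := key t.1 h₂
        exact .inr ⟨h₁.trans_le this.1, this.2⟩

end Refines

/-- All periods of the piece are divisible by `N`, and the inequalities `h x ≤ c` of the list `H`
have constant truth value on the piece for the simple reason that the periods point to one side. -/
def LinearExpr.IsHomogeneous (H : List (((Fin k → ℤ) →+ ℤ) × ℤ)) (N : ℕ) (l : LinearExpr k) : Prop :=
  (∀ p ∈ l.2, ∀ i, (N : ℤ) ∣ p i) ∧
    ∀ s ∈ H, (s.1 l.1 ≤ s.2 ∧ ∀ p ∈ l.2, s.1 p ≤ 0) ∨ (s.2 < s.1 l.1 ∧ ∀ p ∈ l.2, 0 ≤ s.1 p)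

/-- Divisibility comes first; it survives the halfspace splittings because multiples of `N` are
closed under sums. -/
theorem Refines.isHomogeneous (H : List (((Fin k → ℤ) →+ ℤ) × ℤ)) {N : ℕ} (hN : 0 < N)
    (l : LinearExpr k) : Refines (LinearExpr.IsHomogeneous H N) l := by
  refine (forall_period (G := fun p => ∀ i, (N : ℤ) ∣ p i) l fun p _ => ⟨N, hN, fun i => ?_⟩).bind
    fun l hl => (forall_halfspace H l).isPart.bind fun l' hl' => .leaf _ ⟨fun p hp => ?_, hl'.1⟩
  · simp
  · have : AddSubmonoid.closure {p | p ∈ l.2} ≤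
        (AddSubgroup.pi Set.univ fun _ : Fin k => AddSubgroup.zmultiples (N : ℤ)).toAddSubmonoid :=
      AddSubmonoid.closure_le.2 fun p hp i _ => Int.mem_zmultiples_iff.2 (hl p hp i)
    exact fun i => Int.mem_zmultiples_iff.1 (this (hl'.2.2 p hp) i trivial)

end Refinement

/-! ### Linear sets are determined by inequalities and congruences -/

section Determined

open scoped Pointwise

variable {k : ℕ}

/-- Membership in `S` depends only on the truth values of the inequalities `h x ≤ c` in the list `H`
and on the residue of `x` modulo `N`. -/
def DeterminedBy (H : List (((Fin k → ℤ) →+ ℤ) × ℤ)) (N : ℕ) (S : Set (Fin k → ℤ)) : Prop :=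
  ∀ x y, (∀ s ∈ H, s.1 x ≤ s.2 ↔ s.1 y ≤ s.2) → (∀ i, (N : ℤ) ∣ x i - y i) → (x ∈ S ↔ y ∈ S)

/-- Membership in `S` depends only on finitely many linear inequalities and congruences. -/
def IsDetermined (S : Set (Fin k → ℤ)) : Prop :=
  ∃ H N, 0 < N ∧ DeterminedBy H N S

namespace IsDetermined

theorem exists_forall {ι : Type*} [Finite ι] {S : ι → Set (Fin k → ℤ)}
    (hS : ∀ i, IsDetermined (S i)) : ∃ H N, 0 < N ∧ ∀ i, DeterminedBy H N (S i) := by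
  choose H N hN h using hS
  have := Fintype.ofFinite ι
  refine ⟨Finset.univ.toList.flatMap H, ∏ i, N i, Finset.prod_pos fun i _ => hN i,
    fun i x y hH hxy => h i x y (fun s hs => hH s ?_) fun j => ?_⟩
  · exact List.mem_flatMap.2 ⟨i, by simp, hs⟩
  · exact (Int.natCast_dvd_natCast.2 (Finset.dvd_prod_of_mem N (Finset.mem_univ i))).trans (hxy j)

/-- A set that is described by the membership in finitely many determined sets is determined. -/
theorem of_forall {ι : Type*} [Finite ι] {S : ι → Set (Fin k → ℤ)} (hS : ∀ i, IsDetermined (S i))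
    {T : Set (Fin k → ℤ)} (hT : ∀ x y, (∀ i, x ∈ S i ↔ y ∈ S i) → x ∈ T → y ∈ T) :
    IsDetermined T := by
  obtain ⟨H, N, hN, h⟩ := exists_forall hS
  refine ⟨H, N, hN, fun x y hH hxy => ?_⟩
  have key i : x ∈ S i ↔ y ∈ S i := h i x y hH hxy
  exact ⟨hT x y key, hT y x fun i => (key i).symm⟩

theorem setOf_le (h : (Fin k → ℤ) →+ ℤ) (c : ℤ) : IsDetermined {x | h x ≤ c} :=
  ⟨[(h, c)], 1, one_pos, fun _ _ H _ => H (h, c) (by simp)⟩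

theorem setOf_eq (h : (Fin k → ℤ) →+ ℤ) (c : ℤ) : IsDetermined {x | h x = c} := by
  refine ⟨[(h, c), (-h, -c)], 1, one_pos, fun x y H _ => ?_⟩
  have h₁ := H (h, c) (by simp)
  have h₂ := H (-h, -c) (by simp)
  simp only [AddMonoidHom.neg_apply] at h₁ h₂
  change h x = c ↔ h y = c
  omega

theorem setOf_dvd (h : (Fin k → ℤ) →+ ℤ) (c : ℤ) {d : ℕ} (hd : 0 < d) :
    IsDetermined {x | (d : ℤ) ∣ h x - c} := by
  refine ⟨[], d, hd, fun x y _ hxy => ?_⟩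
  choose w hw using hxy
  have : x = y + d • w := by
    ext i
    have := hw i
    rw [Pi.add_apply, Pi.smul_apply, nsmul_eq_mul]
    omega
  change (d : ℤ) ∣ h x - c ↔ (d : ℤ) ∣ h y - c
  rw [this, map_add, map_nsmul, nsmul_eq_mul, add_sub_right_comm]
  exact dvd_add_left (dvd_mul_right _ _)

end IsDetermined

/-- A rational relation can be taken integral; moving its negative part across gives two equal sums
with natural coefficients. -/
theorem linearIndepOn_rat_of_nat {s : Set (Fin k → ℤ)} (hs : LinearIndepOn ℕ id s) :
    LinearIndepOn ℚ ((Int.castAddHom ℚ).compLeft (Fin k)) s := by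
  have inj (x y : Fin k → ℤ) (h : (Int.castAddHom ℚ).compLeft (Fin k) x =
      (Int.castAddHom ℚ).compLeft (Fin k) y) : x = y := by
    ext i
    simpa using congr_fun h i
  rw [LinearIndepOn, ← LinearIndependent.iff_fractionRing ℤ ℚ, ← LinearIndepOn, linearIndepOn_iff'']
  intro t f ht hf heq i hi
  rw [linearIndepOn_iff_linearIndepOn_finset] at hs
  specialize hs t ht
  rw [linearIndepOn_finset_iffₛ] at hs
  specialize hs (Int.toNat ∘ f) (Int.toNat ∘ (-·) ∘ f) ?_ i hi
  · refine inj _ _ ?_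
    rw [map_sum, map_sum, ← sub_eq_zero, ← Finset.sum_sub_distrib, ← heq]
    refine Finset.sum_congr rfl fun j hj => ?_
    conv_rhs => rw [← (f j).toNat_sub_toNat_neg]
    simp only [sub_smul, map_nsmul, natCast_zsmul, Function.comp_apply, id_eq]
  · rw [← (f i).toNat_sub_toNat_neg, sub_eq_zero, Int.natCast_inj]
    simpa using hs

/-- Independent vectors of `ℤ^k` have, up to a common multiple, a dual family of functionals. -/
theorem exists_dual_of_linearIndepOn {t : Finset (Fin k → ℤ)}
    (ht : LinearIndepOn ℕ id (t : Set (Fin k → ℤ))) :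
    ∃ d : ℕ, 0 < d ∧ ∃ g : t → ((Fin k → ℤ) →+ ℤ),
      ∀ i j : t, g i j = if i = j then (d : ℤ) else 0 := by
  have hQ : LinearIndependent ℚ fun i : t => (Int.castAddHom ℚ).compLeft (Fin k) i :=
    linearIndepOn_rat_of_nat ht
  obtain ⟨L, hL⟩ := LinearMap.exists_leftInverse_of_injective _ (LinearMap.ker_eq_bot.2
    (linearIndependent_iff_injective_finsuppLinearCombination.1 hQ))
  obtain ⟨⟨b, hb⟩, hbz⟩ := IsLocalization.exist_integer_multiples_of_finite (nonZeroDivisors ℤ)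
    fun z : t × Fin k => L (Pi.single z.2 1) z.1
  choose z hz using hbz
  have hb0 : b ≠ 0 := nonZeroDivisors.ne_zero hb
  -- The common denominator `b` may be negative; scaling by its square makes the diagonal value
  -- positive.
  refine ⟨b.natAbs * b.natAbs, Nat.mul_pos (Int.natAbs_pos.2 hb0) (Int.natAbs_pos.2 hb0),
    fun i => AddMonoidHom.mk' (fun x => ∑ j, b * z (i, j) * x j) fun x y => ?_, fun i j => ?_⟩
  · simp only [Pi.add_apply, mul_add, Finset.sum_add_distrib]
  · have hLj : L ((Int.castAddHom ℚ).compLeft (Fin k) j) i = if i = j then 1 else 0 := by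
      have := DFunLike.congr_fun (LinearMap.congr_fun hL (Finsupp.single j 1)) i
      simpa [Finsupp.single_apply, eq_comm] using this
    rw [← Finset.univ_sum_single ((Int.castAddHom ℚ).compLeft (Fin k) j)] at hLj
    have e (l : Fin k) : (Pi.single l ((Int.castAddHom ℚ).compLeft (Fin k) j l) : Fin k → ℚ) =
        (j.1 l : ℚ) • Pi.single l 1 := by
      rw [← Pi.single_smul]
      simp
    simp only [e, map_sum, map_smul, Finsupp.coe_finsetSum, Finset.sum_apply, Finsupp.smul_apply,
      smul_eq_mul] at hLj
    have hz' (l : Fin k) : (z (i, l) : ℚ) = b * L (Pi.single l 1) i := by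
      simpa [Algebra.smul_def] using hz (i, l)
    rw [← Int.cast_inj (α := ℚ)]
    simp only [AddMonoidHom.mk'_apply, Int.cast_sum, Int.cast_mul, hz', Nat.cast_mul,
      Int.natAbs_mul_self']
    calc _ = (b : ℚ) * b * ∑ l, (j.1 l : ℚ) * L (Pi.single l 1) i := by
          rw [Finset.mul_sum]
          exact Finset.sum_congr rfl fun l _ => by ring
      _ = _ := by rw [hLj]; split_ifs <;> simp

/-- The dual functionals read off `d` times the coefficients of `x - a`. The equations `f j x = f j
a` put `x - a` in the rational span of `t`; the inequalities and congruences make its coefficients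
natural numbers. -/
theorem IsProperLinearSet.isDetermined {S : Set (Fin k → ℤ)} (hS : IsProperLinearSet S) :
    IsDetermined S := by
  obtain ⟨a, t, ht, rfl⟩ := isProperLinearSet_iff.1 hS
  obtain ⟨d, hd, g, hg⟩ := exists_dual_of_linearIndepOn ht
  let f (j : Fin k) : (Fin k → ℤ) →+ ℤ :=
    AddMonoidHom.mk' (fun x => d * x j - ∑ i, g i x * i.1 j) fun x y => by
      simp only [Pi.add_apply, map_add, add_mul, Finset.sum_add_distrib]
      ring
  have key (x : Fin k → ℤ) : x ∈ a +ᵥ (AddSubmonoid.closure (t : Set (Fin k → ℤ)) :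
      Set (Fin k → ℤ)) ↔ (∀ j, f j x = f j a) ∧ (∀ i, ¬ g i x ≤ g i a - 1) ∧
        ∀ i, (d : ℤ) ∣ g i x - g i a := by
    have hsum (n : t → ℕ) (i : t) : g i (∑ j, n j • j.1) = n i * d := by
      simp only [map_sum, map_nsmul, hg, smul_ite, smul_zero, Finset.sum_ite_eq, Finset.mem_univ,
        if_true]
      rw [nsmul_eq_mul]
    rw [Set.mem_vadd_set]
    constructor
    · rintro ⟨y, hy, rfl⟩
      obtain ⟨n, rfl⟩ := AddSubmonoid.mem_closure_finset'.1 hy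
      refine ⟨fun j => ?_, fun i => ?_, fun i => ?_⟩
      · rw [vadd_eq_add, map_add, add_eq_left]
        simp only [f, AddMonoidHom.mk'_apply, hsum]
        simp only [Finset.sum_apply, Pi.smul_apply]
        simp only [nsmul_eq_mul, Finset.mul_sum, ← Finset.sum_sub_distrib]
        exact Finset.sum_eq_zero fun i _ => by ring
      · rw [vadd_eq_add, map_add, hsum]
        have : (0 : ℤ) ≤ n i * d := by positivity
        omega
      · rw [vadd_eq_add, map_add, hsum, add_sub_cancel_left]
        exact dvd_mul_left _ _
    · rintro ⟨h₁, h₂, h₃⟩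
      have h₄ (i : t) : ∃ n : ℕ, g i (x - a) = d * n := by
        obtain ⟨m, hm⟩ := h₃ i
        have h₀ := h₂ i
        have : 0 ≤ m := by
          have : 0 ≤ (d : ℤ) * m := by omega
          exact nonneg_of_mul_nonneg_right this (by exact_mod_cast hd)
        exact ⟨m.toNat, by rw [map_sub, hm, Int.toNat_of_nonneg this]⟩
      choose n hn using h₄
      refine ⟨x - a, AddSubmonoid.mem_closure_finset'.2 ⟨n, ?_⟩, by simp⟩
      ext j
      have : f j (x - a) = 0 := by rw [map_sub, h₁, sub_self]
      simp only [f, AddMonoidHom.mk'_apply, hn, mul_assoc, ← Finset.mul_sum, ← mul_sub] at this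
      have hd' : (d : ℤ) ≠ 0 := by exact_mod_cast hd.ne'
      rw [sub_eq_zero.1 ((mul_eq_zero.1 this).resolve_left hd')]
      simp
  refine IsDetermined.of_forall (ι := Fin k ⊕ t ⊕ t)
    (S := Sum.elim (fun j => {x | f j x = f j a})
      (Sum.elim (fun i => {x | g i x ≤ g i a - 1}) fun i => {x | (d : ℤ) ∣ g i x - g i a})) ?_ ?_
  · rintro (j | i | i)
    exacts [.setOf_eq _ _, .setOf_le _ _, .setOf_dvd _ _ hd]
  · intro x y hxy hx
    rw [key] at hx ⊢
    exact ⟨fun j => (hxy (.inl j)).1 (hx.1 j), fun i h => hx.2.1 i ((hxy (.inr (.inl i))).2 h),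
      fun i => (hxy (.inr (.inr i))).1 (hx.2.2 i)⟩

theorem LinearExpr.isLinearSet (e : LinearExpr k) : IsLinearSet e.toSet := by
  refine ⟨e.1, {p | p ∈ e.2}, e.2.finite_toSet, ?_⟩
  ext x
  simp [Set.mem_vadd_set, LinearExpr.mem_toSet, eq_comm]

theorem LinearExpr.isDetermined (e : LinearExpr k) : IsDetermined e.toSet := by
  obtain ⟨T, hT, hT', h⟩ := e.isLinearSet.isProperSemilinearSet
  have := hT.to_subtype
  refine IsDetermined.of_forall (S := fun t : T => t.1) (fun t => (hT' t t.2).isDetermined) ?_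
  rw [h]
  rintro x y hxy ⟨t, ht, hx⟩
  exact ⟨t, ht, (hxy ⟨t, ht⟩).1 hx⟩

end Determined

/-! ### Completeness: a certificate always exists -/

section Certificates

variable {k : ℕ}

open Filter

theorem VecOps.eventually_mem_reach {a x : Fin k → ℤ} {Q : List (Fin k → ℤ)}
    (h : x ∈ LinearExpr.toSet (a, Q)) : ∀ᶠ n in atTop, x ∈ (VecOps.pi k).reach Q n a := by
  have mono : Monotone fun n => {x | x ∈ (VecOps.pi k).reach Q n a} :=
    monotone_nat_of_le_succ fun n x hx => by
      simp only [reach, Function.iterate_succ_apply', Set.mem_ofPred_eq] at hx ⊢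
      exact List.mem_append_left _ hx
  suffices ∃ n, x ∈ (VecOps.pi k).reach Q n a by
    obtain ⟨n, hn⟩ := this
    exact eventually_atTop.2 ⟨n, fun m hm => mono hm hn⟩
  obtain ⟨b, hb, rfl⟩ := h
  induction hb using AddSubmonoid.closure_induction_right with
  | zero => exact ⟨0, by simp [reach]⟩
  | add_right y _ q hq ih =>
    obtain ⟨n, hn⟩ := ih
    refine ⟨n + 1, ?_⟩
    simp only [reach, Function.iterate_succ_apply'] at hn ⊢
    exact List.mem_append_right _ (List.mem_flatMap.2 ⟨_, hn, List.mem_map.2 ⟨q, hq, add_assoc _ _ _⟩⟩)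

theorem VecOps.eventually_inside {l f : LinearExpr k} (h₁ : l.1 ∈ f.toSet)
    (h₂ : ∀ p ∈ l.2, p ∈ AddSubmonoid.closure {p | p ∈ f.2}) :
    ∀ᶠ n in atTop, (VecOps.pi k).inside n l f = true := by
  have h₃ : ∀ᶠ n in atTop, ∀ p ∈ {p | p ∈ l.2},
      p ∈ (VecOps.pi k).reach f.2 n ((VecOps.pi k).smul 0 f.1) :=
    (eventually_all_finite l.2.finite_toSet).2 fun p hp => eventually_mem_reach
      ⟨p, h₂ p hp, by simp [VecOps.pi]⟩
  filter_upwards [eventually_mem_reach h₁, h₃] with n hn₁ hn₂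
  simpa [inside] using ⟨hn₁, hn₂⟩

/-- If a linear set contains a ray, then some multiple of the direction of the ray is a sum of
periods. -/
theorem LinearExpr.exists_smul_mem_closure {f : LinearExpr k} {a p : Fin k → ℤ}
    (h : ∀ n : ℕ, a + n • p ∈ f.toSet) :
    ∃ m : ℕ, 0 < m ∧ m • p ∈ AddSubmonoid.closure {p | p ∈ f.2} := by
  classical
  have e : {p | p ∈ f.2} = (f.2.toFinset : Set (Fin k → ℤ)) := by ext; simp
  simp only [LinearExpr.mem_toSet, e, AddSubmonoid.mem_closure_finset'] at h ⊢
  choose b hb hab using h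
  choose c hc using hb
  -- Dickson's lemma for the coefficient vectors of the points on the ray: a comparable pair differs
  -- by natural coefficients representing `(j - i) • p`.
  obtain ⟨i, j, hij, hle⟩ := wellQuasiOrdered_le c
  refine ⟨j - i, Nat.sub_pos_of_lt hij, c j - c i, ?_⟩
  have h₁ : (j - i) • p + b i = b j := by
    have h₂ := hab i
    have h₃ := hab j
    obtain ⟨r, rfl⟩ := Nat.exists_eq_add_of_le hij.le
    rw [add_smul, ← add_assoc, h₂, add_assoc, add_left_cancel_iff] at h₃
    rw [Nat.add_sub_cancel_left, add_comm, h₃]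
  refine add_right_cancel (b := b i) (h₁.trans ?_)
  rw [hc, hc, ← Finset.sum_add_distrib]
  exact Finset.sum_congr rfl fun q _ => by rw [← add_smul, Pi.sub_apply, Nat.sub_add_cancel (hle q)]

/-- Adding periods changes neither the truth value of an inequality in `H` nor the residue modulo
`N`. -/
theorem LinearExpr.IsHomogeneous.toSet_subset {H : List (((Fin k → ℤ) →+ ℤ) × ℤ)} {N : ℕ}
    {l : LinearExpr k} (hl : l.IsHomogeneous H N) {S : Set (Fin k → ℤ)} (hS : DeterminedBy H N S)
    (h : l.1 ∈ S) : l.toSet ⊆ S := by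
  rintro _ ⟨b, hb, rfl⟩
  refine (hS _ _ (fun s hs => ?_) fun i => ?_).1 h
  · have key (f : (Fin k → ℤ) →+ ℤ) (hf : ∀ p ∈ l.2, 0 ≤ f p) : 0 ≤ f b :=
      (AddSubmonoid.closure_le (S := (AddSubmonoid.nonneg ℤ).comap f)).2 hf hb
    rw [map_add]
    rcases hl.2 s hs with ⟨h₁, h₂⟩ | ⟨h₁, h₂⟩
    · have := key (-s.1) fun p hp => by simpa using h₂ p hp
      rw [AddMonoidHom.neg_apply] at this
      omega
    · have := key s.1 h₂
      omega
  · have : AddSubmonoid.closure {p | p ∈ l.2} ≤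
        (AddSubgroup.pi Set.univ fun _ : Fin k => AddSubgroup.zmultiples (N : ℤ)).toAddSubmonoid :=
      AddSubmonoid.closure_le.2 fun p hp i _ => Int.mem_zmultiples_iff.2 (hl.1 p hp i)
    have := Int.mem_zmultiples_iff.1 (this hb i trivial)
    simpa using this

theorem VecOps.pi_dot_ofFn (h : (Fin k → ℤ) →+ ℤ) (x : Fin k → ℤ) :
    (VecOps.pi k).dot (List.ofFn fun i => h (Pi.single i 1)) x = h x := by
  have e : x = ∑ i, x i • Pi.single i (1 : ℤ) := by
    ext j
    simp [Finset.sum_apply, Pi.single_apply]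
  conv_rhs => rw [e, map_sum]
  refine (list_dot_ofFn _ _).trans (Finset.sum_congr rfl fun i _ => ?_)
  rw [map_zsmul, smul_eq_mul, mul_comm]

/-- The separating functionals that belong to a list of inequalities and a modulus. -/
def VecOps.separators (H : List (((Fin k → ℤ) →+ ℤ) × ℤ)) (N : ℕ) : List (List ℤ × ℕ) :=
  (H.map (·.1) ++ H.map (-·.1) ++ List.ofFn fun i : Fin k => Pi.evalAddMonoidHom (fun _ => ℤ) i).map
    fun h => (List.ofFn fun i => h (Pi.single i 1), N)

/-- Since `S` contains only one of the two bases, they differ in an inequality or a residue. In the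
first case the periods point to opposite sides, so `±h` separates; in the second a coordinate does,
modulo `N`. -/
theorem VecOps.exists_separates {H : List (((Fin k → ℤ) →+ ℤ) × ℤ)} {N : ℕ} {l f : LinearExpr k}
    (hl : l.IsHomogeneous H N) (hf : f.IsHomogeneous H N) {S : Set (Fin k → ℤ)}
    (hS : DeterminedBy H N S) (hlS : l.1 ∉ S) (hfS : f.1 ∈ S) :
    ∃ s ∈ separators H N, (VecOps.pi k).separates s l f = true := by
  have mem {h : (Fin k → ℤ) →+ ℤ} (hh : h ∈ H.map (·.1) ++ H.map (-·.1) ++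
      List.ofFn fun i : Fin k => Pi.evalAddMonoidHom (fun _ => ℤ) i)
      (h' : h f.1 < h l.1 ∧ (∀ p ∈ l.2, 0 ≤ h p) ∧ (∀ p ∈ f.2, h p ≤ 0) ∨
        ¬ (N : ℤ) ∣ h l.1 - h f.1 ∧ (∀ p ∈ l.2, (N : ℤ) ∣ h p) ∧ ∀ p ∈ f.2, (N : ℤ) ∣ h p) :
      ∃ s ∈ separators H N, (VecOps.pi k).separates s l f = true := by
    refine ⟨_, List.mem_map.2 ⟨h, hh, rfl⟩, ?_⟩
    simpa [separates, pi_dot_ofFn] using h'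
  by_contra hne
  refine hlS ((hS _ _ (fun s hs => ?_) fun i => ?_).2 hfS)
  · have h₁ := mt (mem (h := s.1) (List.mem_append_left _ (List.mem_append_left _
      (List.mem_map.2 ⟨s, hs, rfl⟩)))) hne
    have h₂ := mt (mem (h := -s.1) (List.mem_append_left _ (List.mem_append_right _
      (List.mem_map.2 ⟨s, hs, rfl⟩)))) hne
    simp only [AddMonoidHom.neg_apply, neg_nonneg, neg_nonpos, neg_lt_neg_iff, not_or] at h₁ h₂
    rcases hl.2 s hs with h₃ | h₃ <;> rcases hf.2 s hs with h₄ | h₄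
    · exact iff_of_true h₃.1 h₄.1
    · exact absurd ⟨h₃.1.trans_lt h₄.1, h₃.2, h₄.2⟩ h₂.1
    · exact absurd ⟨h₄.1.trans_lt h₃.1, h₃.2, h₄.2⟩ h₁.1
    · exact iff_of_false h₃.1.not_ge h₄.1.not_ge
  · by_contra hi
    exact hne (mem (h := Pi.evalAddMonoidHom (fun _ => ℤ) i) (by simp)
      (.inr ⟨hi, fun p hp => hl.1 p hp i, fun p hp => hf.1 p hp i⟩))

theorem VecOps.exists_diff_eq_some (E F : SemilinearExpr k) :
    ∃ c D, (VecOps.pi k).diff E F c = some D := by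
  obtain ⟨H, N, hN, hF⟩ := IsDetermined.exists_forall fun i : Fin F.length => (F.get i).isDetermined
  replace hF (f : LinearExpr k) (hf : f ∈ F) : DeterminedBy H N f.toSet := by
    obtain ⟨i, rfl⟩ := List.get_of_mem hf
    exact hF i
  obtain ⟨cF, hcF⟩ := Refines.exists_run fun l (_ : l ∈ F) => Refines.isHomogeneous H hN l
  have hE (l : LinearExpr k) : Refines (fun l => (l.IsHomogeneous H N ∧ l.1 ∉ F.toSet) ∨
      ∀ᶠ n in atTop, ∃ f ∈ F, (VecOps.pi k).inside n l f = true) l := by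
    refine (Refines.isHomogeneous H hN l).bind fun l hl => ?_
    by_cases hlF : l.1 ∈ F.toSet
    · obtain ⟨f, hf, hlf⟩ := hlF
      have hsub := hl.toSet_subset (hF f hf) hlf
      -- The piece lies in `f`, hence so do its rays, and each period has a multiple that is a sum
      -- of periods of `f`.
      refine (Refines.forall_period l fun p hp => LinearExpr.exists_smul_mem_closure
        (f := f) (a := l.1) fun n => hsub ?_).isPart.bind fun l' hl' => .leaf _ (.inr ?_)
      · exact LinearExpr.add_mem (LinearExpr.base_mem l) (AddSubmonoid.nsmul_mem _ 
          (AddSubmonoid.subset_closure (show p ∈ {p | p ∈ l.2} from hp)) n)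
      · exact (eventually_inside (hsub hl'.2.1) hl'.1).mono fun n hn => ⟨f, hf, hn⟩
    · exact .leaf _ (.inl ⟨hl, hlF⟩)
  obtain ⟨cE, hcE⟩ := Refines.exists_run fun l (_ : l ∈ E) => hE l
  -- One search depth serves all of the finitely many pieces.
  obtain ⟨n, hn⟩ := ((eventually_all_finite (List.finite_toSet _)).2 fun l hl =>
    (eventually_or_distrib_left.2 (hcE l hl) : ∀ᶠ n in atTop, _)).exists
  refine ⟨((cE, cF), n, separators H N), _, if_pos (List.all_eq_true.2 fun l hl => ?_)⟩
  rw [Bool.or_eq_true, List.any_eq_true]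
  refine (hn l hl).imp_left fun hl => ?_
  simp only [separated, List.all_eq_true, List.any_eq_true]
  intro f hf
  have : f.1 ∈ F.toSet := by
    rw [← toSet_run cF]
    exact ⟨f, hf, LinearExpr.base_mem f⟩
  -- The base of the split piece lies in an original `g`, whose membership is determined by `H` and
  -- `N`.
  obtain ⟨g, hg, hfg⟩ := this
  exact exists_separates hl.1 (hcF f hf) (hF g hg) (fun h => hl.2 ⟨g, hg, h⟩) hfg

end Certificates

/-! ### The search algorithm -/

section Algorithm

open Primrec

/-- The expression over `ℤ^k` that is described by given data, where vectors are cut off or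
extended by `0`. -/
def SemilinearCode.toExpr (k : ℕ) (c : SemilinearCode) : SemilinearExpr k :=
  c.map fun e => (fun i => e.1.getD i 0, e.2.map fun p i => p.getD i 0)

theorem SemilinearExpr.toExpr_code {k : ℕ} (E : SemilinearExpr k) :
    SemilinearCode.toExpr k E.code = E := by
  simp [SemilinearCode.toExpr, SemilinearExpr.code, Function.comp_def]

/-- Normalising the input turns malformed codes into genuine expressions too, so the search is
total. -/
theorem SemilinearCode.primrec_code_toExpr :
    Primrec fun z : ℕ × SemilinearCode => (SemilinearCode.toExpr z.1 z.2).code := by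
  have h : Primrec₂ fun (k : ℕ) (v : List ℤ) => (List.range k).map fun i => v.getD i 0 :=
    list_map (list_range.comp .fst) ((list_getD 0).comp (snd.comp .fst) .snd).to₂
  refine (list_map (f := fun z : ℕ × SemilinearCode => z.2)
    (g := fun z e => ((List.range z.1).map fun i => e.1.getD i 0,
      e.2.map fun p => (List.range z.1).map fun i => p.getD i 0)) .snd
    (Primrec.pair (h.comp (fst.comp .fst) (fst.comp .snd))
      (list_map (snd.comp .snd) (h.comp (fst.comp (fst.comp .fst)) .snd).to₂))).of_eq fun z => ?_
  have e (v : List ℤ) : (List.range z.1).map (fun i => v.getD i 0) =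
      List.ofFn fun i : Fin z.1 => v.getD i 0 :=
    List.ext_getElem (by simp) fun i _ _ => by simp
  simp only [SemilinearCode.toExpr, SemilinearExpr.code, e, List.map_map, Function.comp_def]

end Algorithm

/-- The difference of two semilinear subsets of `ℤ^k` is semilinear, and a single (total) computable
function produces, from `k` and semilinear expressions for `X` and `Y`, a semilinear expression
for `X \ Y`. -/
theorem mainTheorem7 :
    (∀ (k : ℕ) (X Y : Set (Fin k → ℤ)),
      IsSemilinearSet X → IsSemilinearSet Y → IsSemilinearSet (X \ Y)) ∧
    ∃ diff : ℕ × SemilinearCode × SemilinearCode → SemilinearCode,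
      Computable diff ∧
      ∀ (k : ℕ) (E F : SemilinearExpr k), ∃ D : SemilinearExpr k,
        diff (k, E.code, F.code) = D.code ∧ D.toSet = E.toSet \ F.toSet := by
  refine ⟨fun k X Y hX hY => hX.sdiff hY, ?_⟩
  let f (z : ℕ × SemilinearCode × SemilinearCode) (n : ℕ) : Option SemilinearCode :=
    (Encodable.decode (α := DiffCert) n).bind fun c =>
      VecOps.list.diff (SemilinearCode.toExpr z.1 z.2.1).code (SemilinearCode.toExpr z.1 z.2.2).code c
  have hf : Primrec₂ f :=
    Primrec.option_bind (Primrec.decode.comp .snd) (VecOps.primrec_diff.comp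
      (.pair (.pair
        (SemilinearCode.primrec_code_toExpr.comp (.pair (.comp .fst (.comp .fst .fst))
          (.comp .fst (.comp .snd (.comp .fst .fst)))))
        (SemilinearCode.primrec_code_toExpr.comp (.pair (.comp .fst (.comp .fst .fst))
          (.comp .snd (.comp .snd (.comp .fst .fst))))))
        .snd)).to₂
  have hmap {k : ℕ} (E F : SemilinearExpr k) (c : DiffCert) :
      VecOps.list.diff E.code F.code c = ((VecOps.pi k).diff E F c).map SemilinearExpr.code :=
    (VecOps.isHom_ofFn k).diff_map E F c
  -- Completeness gives termination on every input.
  have hdom z : (Nat.rfindOpt (f z)).Dom := by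
    obtain ⟨c, D, h⟩ := VecOps.exists_diff_eq_some (SemilinearCode.toExpr z.1 z.2.1)
      (SemilinearCode.toExpr z.1 z.2.2)
    refine Nat.rfindOpt_dom.2 ⟨Encodable.encode c, SemilinearExpr.code D, ?_⟩
    simp only [f, Encodable.encodek, Option.bind_some, hmap, h, Option.map_some, Option.mem_def]
  refine ⟨fun z => (Nat.rfindOpt (f z)).get (hdom z),
    (Partrec.rfindOpt hf.to_comp).of_eq_tot fun z => Part.get_mem _, fun k E F => ?_⟩
  -- Whichever certificate is found, soundness makes the output correct.
  obtain ⟨n, hn⟩ := Nat.rfindOpt_spec (Part.get_mem (hdom (k, E.code, F.code)))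
  obtain ⟨c, -, hc⟩ := Option.mem_bind_iff.1 hn
  simp only [SemilinearExpr.toExpr_code, hmap] at hc
  obtain ⟨D, hD, e⟩ := Option.mem_map.1 hc
  exact ⟨D, e.symm, VecOps.toSet_diff hD⟩
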